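/- Let $\mathbb X$ be a real Banach space with a semi-normalized Schauder basis $\mathcal B=(e_n)_{n\ge1}$ and biorthogonal functionals $(e_n^*)_{n\ge1}\subset\mathbb X^*$; that is, $e_n^*(e_m)=\delta_{n,m}$, $x=\lim_{N\to\infty}\sum_{n=1}^N e_n^*(x)e_n$ for every $x\in\mathbb X$, and there are constants $c_1,c_2>0$ with $c_1\le\|e_n\|,\|e_n^*\|\le c_2$ for all $n$. For a finite set $\Gamma\subset\mathbb N=\{1,2,\dots\}$ put $P_\Gamma(x)=\sum_{n\in\Gamma}e_n^*(x)e_n$. A greedy ordering of $x$ is an injective map $\rho:\mathbb N\to\mathbb N$ with $\{n:e_n^*(x)\ne0\}\subset\rho(\mathbb N)$ such that $j<k$ implies either $|e_{\rho(j)}^*(x)|>|e_{\rho(k)}^*(x)|$, or $|e_{\rho(j)}^*(x)|=|e_{\rho(k)}^*(x)|$ and $\rho(j)<\rho(k)$; the greedy sums of $x$ are $\mathcal G_m(x)=\sum_{n=1}^m e_{\rho(n)}^*(x)e_{\rho(n)}$. The basis is quasi-greedy if $\mathcal G_m(x)\to x$ for all $x\in\mathbb X$, and unconditional if $\sum_n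 e_n^*(x)e_n$ converges unconditionally for all $x\in\mathbb X$. Fix $t\in(0,1]$ and nonempty sets $A,B\subset\mathbb N$. For $a,b\in\mathbb N$, a finite set $\Gamma\subset\mathbb N$ with $|\Gamma|\ge a$ is an $(a,b,t)$-weak greedy set of $x$ if $$s_a\ \ge\ t\,\ell_b,$$ where $s_a$ is the $a$-th smallest of the numbers $|e_n^*(x)|$, $n\in\Gamma$, and $\ell_b$ is the $b$-th largest of the numbers $|e_n^*(x)|$, $n\notin\Gamma$ (both counted with multiplicity). The basis has the $(A,B,t)$-quasi-greedy property if there is a constant $C>0$ such that $\|P_\Gamma(x)\|\le C\|x\|$ for all $a\in A$, $b\in B$, $x\in\mathbb X$ and all $(a,b,t)$-weak greedy sets $\Gamma$ of $x$. Then: (i) If $A\cup B$ is finite, then $\mathcal B$ is quasi-greedy if and only if $\mathcal B$ has the $(A,B,t)$-quasi-greedy property. (ii) If $A\cup B$ is finite, then $\mathcal B$ is quasi-greedy if and only if for every $x\in\mathbb X$, every sequence $(a_m)_{m\ge\max A}$ in $A$ and every choice of $(a_m,1,t)$-weak greedy sets $\Gamma_m$ of $x$ with $|\Gamma_m|=m$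 ($m\ge\max A$), we have $P_{\Gamma_m}(x)\to x$. (iii) If $A\cup B$ is infinite, then $\mathcal B$ has the $(A,B,t)$-quasi-greedy property if and only if $\mathcal B$ is unconditional. -/

import Mathlib

open Filter Topology

namespace GreedyBasis

variable {X : Type*} [NormedAddCommGroup X] [NormedSpace ℝ X]

/-- A Schauder basis `(eₙ)` with coordinate functionals `(eₙ*)` is semi-normalized if the norms of
all `eₙ` and all `eₙ*` lie between two positive constants. -/
def IsSemiNormalized (b : SchauderBasis ℝ X) : Prop :=
  ∃ c₁ c₂ : ℝ, 0 < c₁ ∧ 0 < c₂ ∧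
    ∀ n, (c₁ ≤ ‖b n‖ ∧ ‖b n‖ ≤ c₂) ∧ (c₁ ≤ ‖b.coord n‖ ∧ ‖b.coord n‖ ≤ c₂)

/-- `ρ` is a greedy ordering of the coefficient sequence `c`: it is injective, its range contains
the support of `c`, and it lists the coefficients by decreasing modulus, ties being broken by the
order of the indices. -/
def IsGreedyOrdering (c : ℕ → ℝ) (ρ : ℕ → ℕ) : Prop :=
  Function.Injective ρ ∧ Function.support c ⊆ Set.range ρ ∧
    ∀ j k, j < k → |c (ρ k)| < |c (ρ j)| ∨ (|c (ρ j)| = |c (ρ k)| ∧ ρ j < ρ k)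

/-- The coefficient sequence `(eₙ*(x))ₙ` of a vector `x`. -/
noncomputable def coeffs (b : SchauderBasis ℝ X) (x : X) : ℕ → ℝ := fun n => b.coord n x

/-- The greedy sum of order `m` of `x` along `ρ`: the sum of the first `m` terms in that order. -/
noncomputable def greedySum (b : SchauderBasis ℝ X) (ρ : ℕ → ℕ) (m : ℕ) (x : X) : X :=
  ∑ n ∈ Finset.range m, b.coord (ρ n) x • b (ρ n)

/-- Quasi-greedy basis: the greedy sums of every vector converge to that vector. Greedy orderings
always exist for a semi-normalized basis (`exists_isGreedyOrdering_coeffs` below). -/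
def IsQuasiGreedy (b : SchauderBasis ℝ X) : Prop :=
  ∀ (x : X) (ρ : ℕ → ℕ), IsGreedyOrdering (coeffs b x) ρ →
    Tendsto (fun m => greedySum b ρ m x) atTop (𝓝 x)

/-- Unconditional basis: for every `x` the series `∑ eₙ*(x) eₙ` converges unconditionally. -/
def IsUnconditional (b : SchauderBasis ℝ X) : Prop :=
  ∀ x : X, Summable (fun n => b.coord n x • b n)

/-- The `a`-th smallest modulus of a coefficient with index in the finite set `Γ`, counted with
multiplicity (for `1 ≤ a ≤ #Γ`): the least `r` such that at least `a` of the indices in `Γ` carry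
a coefficient of modulus at most `r`. -/
noncomputable def kthSmallestInside (c : ℕ → ℝ) (Γ : Finset ℕ) (a : ℕ) : ℝ :=
  sInf {r : ℝ | a ≤ (Γ.filter fun n => |c n| ≤ r).card}

/-- The `b`-th largest modulus of a coefficient with index outside the finite set `Γ`, counted
with multiplicity (for `1 ≤ b` and `c` tending to zero): the greatest `r` such that at least `b`
of the indices outside `Γ` carry a coefficient of modulus at least `r`. -/
noncomputable def kthLargestOutside (c : ℕ → ℝ) (Γ : Finset ℕ) (b : ℕ) : ℝ :=
  sSup {r : ℝ | (b : ℕ∞) ≤ Set.encard {n : ℕ | n ∉ Γ ∧ r ≤ |c n|}}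

/-- `Γ` is a `(k, l, t)`-weak greedy set of `x`: it has at least `k` elements, and the `k`-th
smallest coefficient (in modulus) inside `Γ` is at least `t` times the `l`-th largest outside. -/
def IsWeakGreedySet (b : SchauderBasis ℝ X) (k l : ℕ) (t : ℝ) (x : X) (Γ : Finset ℕ) : Prop :=
  k ≤ Γ.card ∧ t * kthLargestOutside (coeffs b x) Γ l ≤ kthSmallestInside (coeffs b x) Γ k

/-- The `(A, B, t)`-quasi-greedy property: the `(k, l, t)`-weak greedy sums `P_Γ x`, for `k ∈ A`
and `l ∈ B`, are bounded by `C ‖x‖` with one constant `C`. -/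
def HasQuasiGreedyProperty (b : SchauderBasis ℝ X) (A B : Set ℕ) (t : ℝ) : Prop :=
  ∃ C : ℝ, 0 < C ∧ ∀ k ∈ A, ∀ l ∈ B, ∀ (x : X) (Γ : Finset ℕ),
    IsWeakGreedySet b k l t x Γ → ‖GeneralSchauderBasis.proj b Γ x‖ ≤ C * ‖x‖

/-- Every `(a_m, 1, t)`-weak greedy approximation converges: for every `x`, every sequence `(a_m)`
in `A` and every choice, for `m ≥ max A`, of an `(a_m, 1, t)`-weak greedy set `Γ_m` of `x` of
order `m`, the sums `P_{Γ_m} x` converge to `x`. -/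
def WeakGreedyConverges (b : SchauderBasis ℝ X) (A : Set ℕ) (t : ℝ) : Prop :=
  ∀ (x : X) (a : ℕ → ℕ) (Γ : ℕ → Finset ℕ),
    (∀ m, (∀ k ∈ A, k ≤ m) → a m ∈ A ∧ (Γ m).card = m ∧ IsWeakGreedySet b (a m) 1 t x (Γ m)) →
    Tendsto (fun m => GeneralSchauderBasis.proj b (Γ m) x) atTop (𝓝 x)

/-- The coefficients with respect to a semi-normalized basis tend to zero. -/
theorem tendsto_coeffs (b : SchauderBasis ℝ X) (hb : IsSemiNormalized b) (x : X) :
    Tendsto (coeffs b x) atTop (𝓝 0) := by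
  obtain ⟨c₁, c₂, h1, -, h⟩ := hb
  have hs : Tendsto (fun n => ∑ i ∈ Finset.range n, b.coord i x • b i) atTop (𝓝 x) := by
    simpa only [SchauderBasis.proj_apply] using b.tendsto_proj x
  have hd : Tendsto (fun n => b.coord n x • b n) atTop (𝓝 0) := by
    have h2 := (hs.comp (tendsto_add_atTop_nat 1)).sub hs
    rw [sub_self] at h2
    refine h2.congr fun n => ?_
    simp only [Function.comp_apply]
    rw [Finset.sum_range_succ, add_sub_cancel_left]
  have hd' : Tendsto (fun n => ‖b.coord n x • b n‖ / c₁) atTop (𝓝 0) := by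
    simpa using hd.norm.div_const c₁
  refine squeeze_zero_norm (fun n => ?_) hd'
  rw [le_div_iff₀ h1, norm_smul]
  exact mul_le_mul_of_nonneg_left (h n).1.1 (norm_nonneg _)

/-- A null sequence has a greedy ordering. -/
theorem exists_isGreedyOrdering (c : ℕ → ℝ) (hc : Tendsto c atTop (𝓝 0)) :
    ∃ ρ, IsGreedyOrdering c ρ := by
  have hfin : ∀ k, c k ≠ 0 → {n | |c k| ≤ |c n|}.Finite := by
    intro k hk
    have h0 : Tendsto (fun n => |c n|) atTop (𝓝 0) := by simpa using hc.abs
    have h := h0.eventually (gt_mem_nhds (abs_pos.mpr hk))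
    rw [← Nat.cofinite_eq_atTop] at h
    simpa [Filter.eventually_cofinite] using h
  let prec : ℕ → ℕ → Prop := fun n k => |c k| < |c n| ∨ (|c n| = |c k| ∧ n < k)
  have hpfin : ∀ k, c k ≠ 0 → {n | prec n k}.Finite := fun k hk =>
    (hfin k hk).subset fun n hn => by
      rcases hn with h | h
      · exact h.le
      · exact h.1.ge
  -- every non-empty set of indices has a first element
  have hmin : ∀ s : Set ℕ, s.Nonempty → ∃ n ∈ s, ∀ k ∈ s, k ≠ n → prec n k := by
    intro s hs
    have hmax : ∃ n ∈ s, ∀ k ∈ s, |c k| ≤ |c n| := by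
      by_cases hz : ∃ k ∈ s, c k ≠ 0
      · obtain ⟨k, hks, hk⟩ := hz
        obtain ⟨n, hn, hn'⟩ := Set.exists_max_image (s ∩ {n | |c k| ≤ |c n|}) (fun n => |c n|)
          ((hfin k hk).subset Set.inter_subset_right) ⟨k, hks, le_refl |c k|⟩
        refine ⟨n, hn.1, fun j hj => ?_⟩
        by_cases hjk : |c k| ≤ |c j|
        · exact hn' j ⟨hj, hjk⟩
        · exact (not_le.mp hjk).le.trans hn.2
      · push Not at hz
        obtain ⟨n, hn⟩ := hs
        exact ⟨n, hn, fun k hk => by simp [hz k hk]⟩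
    obtain ⟨n, hn, hn'⟩ := hmax
    classical
    have hex : ∃ j, j ∈ s ∧ |c j| = |c n| := ⟨n, hn, rfl⟩
    refine ⟨Nat.find hex, (Nat.find_spec hex).1, fun k hk hne => ?_⟩
    have he := (Nat.find_spec hex).2
    rcases lt_or_eq_of_le (hn' k hk) with h | h
    · exact Or.inl (by rw [he]; exact h)
    · exact Or.inr ⟨by rw [he, h], lt_of_le_of_ne (Nat.find_min' hex ⟨hk, h⟩) hne.symm⟩
  have hstep : ∀ F : Finset ℕ, ∃ n, n ∉ F ∧ ∀ k, k ∉ F → k ≠ n → prec n k := by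
    intro F
    obtain ⟨n, hn, h⟩ := hmin {n | n ∉ F} (Infinite.exists_notMem_finset F)
    exact ⟨n, hn, h⟩
  choose g hg1 hg2 using hstep
  let S : ℕ → Finset ℕ := fun m => Nat.rec ∅ (fun _ F => insert (g F) F) m
  have hS : ∀ m, S (m + 1) = insert (g (S m)) (S m) := fun m => rfl
  have hmono : Monotone S := monotone_nat_of_le_succ fun m => by
    rw [hS]; exact Finset.subset_insert _ _
  have hmem : ∀ j k, j < k → g (S j) ∈ S k := fun j k hjk =>
    hmono (Nat.succ_le_of_lt hjk) (by
      change g (S j) ∈ S (j + 1)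
      rw [hS]; exact Finset.mem_insert_self _ _)
  have hne : ∀ j k, j < k → g (S k) ≠ g (S j) := fun j k hjk h =>
    hg1 (S k) (h ▸ hmem j k hjk)
  have hinj : Function.Injective fun m => g (S m) := by
    intro j k h
    rcases lt_trichotomy j k with hl | hl | hl
    · exact absurd h.symm (hne j k hl)
    · exact hl
    · exact absurd h (hne k j hl)
  refine ⟨fun m => g (S m), hinj, ?_, fun j k hjk =>
    hg2 (S j) _ (fun h => hg1 (S k) (hmono hjk.le h)) (hne j k hjk)⟩
  intro n hn
  by_contra hr
  have hnS : ∀ m, n ∉ S m := by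
    intro m
    induction m with
    | zero => exact Finset.notMem_empty n
    | succ m ih =>
      rw [hS, Finset.mem_insert, not_or]
      exact ⟨fun h => hr ⟨m, h.symm⟩, ih⟩
  have hsub : Set.range (fun m => g (S m)) ⊆ {k | prec k n} := by
    rintro _ ⟨m, rfl⟩
    exact hg2 (S m) n (hnS m) fun h => hr ⟨m, h.symm⟩
  exact (Set.infinite_range_of_injective hinj) ((hpfin n hn).subset hsub)

/-- Every vector has a greedy ordering with respect to a semi-normalized basis. -/
theorem exists_isGreedyOrdering_coeffs (b : SchauderBasis ℝ X) (hb : IsSemiNormalized b) (x : X) :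
    ∃ ρ, IsGreedyOrdering (coeffs b x) ρ :=
  exists_isGreedyOrdering _ (tendsto_coeffs b hb x)

end GreedyBasis

namespace GreedyBasis

variable {X : Type*} [NormedAddCommGroup X] [NormedSpace ℝ X]

/-! Everything is compared with threshold sets, which keep only coefficients of modulus at least `t
* α` and omit only those of modulus at most `α`. By `IsWeakGreedySet.exists_threshold`, a `(k, l,
t)`-weak greedy set becomes one after deleting fewer than `k` indices and adding fewer than `l`. If
`A ∪ B` is finite, this correction has bounded size and costs only a constant, since coefficients
and basis vectors are uniformly bounded.

The main point is that quasi-greediness gives a uniform bound on threshold projections. A Baire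
category argument bounds projections onto strict superlevel sets. Slightly enlarging the
coefficients in a thin layer turns any part of that layer into part of a superlevel set, so such
parts are bounded too; finitely many layers cover the range from `t * α` to `α`. Conversely, a
threshold bound gives convergence whenever the thresholds tend to zero, because a fixed head is
eventually captured and the bound controls the tail.

If `A` or `B` is infinite, the weak greedy condition can be made vacuous on a prescribed finite set:
many small coefficients are tolerated inside, or many large ones outside. Hence all coordinate
projections are uniformly bounded, which is unconditionality. -/

/-- `Γ` contains only coefficients of modulus at least `t * α`, and misses only coefficients of
modulus at most `α`. -/
def IsThresholdSet (c : ℕ → ℝ) (t α : ℝ) (Γ : Finset ℕ) : Prop :=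
  (∀ n ∈ Γ, t * α ≤ |c n|) ∧ ∀ n ∉ Γ, |c n| ≤ α

/-- The projections onto the threshold sets of a vector `x` are bounded by `C * ‖x‖`. -/
def ThresholdBound (b : SchauderBasis ℝ X) (t C : ℝ) : Prop :=
  ∀ (x : X) (α : ℝ) (Γ : Finset ℕ), 0 ≤ α → IsThresholdSet (coeffs b x) t α Γ →
    ‖GeneralSchauderBasis.proj b Γ x‖ ≤ C * ‖x‖

/-- The projections onto the strict superlevel sets `{n | s < |eₙ*(x)|}`, `0 < s`, are bounded by
`C * ‖x‖`. -/
def SuperlevelBound (b : SchauderBasis ℝ X) (C : ℝ) : Prop :=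
  ∀ (x : X) (s : ℝ) (Γ : Finset ℕ), 0 < s → (∀ n, n ∈ Γ ↔ s < |coeffs b x n|) →
    ‖GeneralSchauderBasis.proj b Γ x‖ ≤ C * ‖x‖

/-! ### Coefficients and coordinate projections -/

theorem coeffs_add (b : SchauderBasis ℝ X) (x y : X) (n : ℕ) :
    coeffs b (x + y) n = coeffs b x n + coeffs b y n := by simp [coeffs]

theorem coeffs_sub (b : SchauderBasis ℝ X) (x y : X) (n : ℕ) :
    coeffs b (x - y) n = coeffs b x n - coeffs b y n := by simp [coeffs]

theorem coeffs_smul (b : SchauderBasis ℝ X) (a : ℝ) (x : X) (n : ℕ) :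
    coeffs b (a • x) n = a * coeffs b x n := by simp [coeffs]

theorem coeffs_basis (b : SchauderBasis ℝ X) (m n : ℕ) :
    coeffs b (b m) n = if n = m then 1 else 0 := by
  simp [coeffs, b.ortho, Pi.single_apply]

theorem coeffs_proj (b : SchauderBasis ℝ X) (Γ : Finset ℕ) (x : X) (n : ℕ) :
    coeffs b (GeneralSchauderBasis.proj b Γ x) n = if n ∈ Γ then coeffs b x n else 0 := by
  simp [coeffs, b.ortho, Pi.single_apply]

theorem proj_eq_sum (b : SchauderBasis ℝ X) (Γ : Finset ℕ) (x : X) :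
    GeneralSchauderBasis.proj b Γ x = ∑ n ∈ Γ, coeffs b x n • b n := by
  simp [coeffs]

theorem proj_congr (b : SchauderBasis ℝ X) {Γ : Finset ℕ} {x y : X}
    (h : ∀ n ∈ Γ, coeffs b x n = coeffs b y n) :
    GeneralSchauderBasis.proj b Γ x = GeneralSchauderBasis.proj b Γ y := by
  rw [proj_eq_sum, proj_eq_sum]
  exact Finset.sum_congr rfl fun n hn => by rw [h n hn]

theorem proj_union (b : SchauderBasis ℝ X) {Γ Δ : Finset ℕ} (h : Disjoint Γ Δ) (x : X) :
    GeneralSchauderBasis.proj b (Γ ∪ Δ) x =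
      GeneralSchauderBasis.proj b Γ x + GeneralSchauderBasis.proj b Δ x := by
  simp only [proj_eq_sum, Finset.sum_union h]

theorem proj_subset (b : SchauderBasis ℝ X) {Γ Δ : Finset ℕ} (h : Γ ⊆ Δ) {x : X}
    (h0 : ∀ n ∈ Δ, n ∉ Γ → coeffs b x n = 0) :
    GeneralSchauderBasis.proj b Γ x = GeneralSchauderBasis.proj b Δ x := by
  simp only [proj_eq_sum]
  exact Finset.sum_subset h fun n hn hn' => by simp [h0 n hn hn']

theorem proj_eq_self (b : SchauderBasis ℝ X) {Γ : Finset ℕ} {x : X}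
    (h : ∀ n ∉ Γ, coeffs b x n = 0) : GeneralSchauderBasis.proj b Γ x = x := by
  refine tendsto_nhds_unique ?_ (b.tendsto_proj x)
  refine tendsto_const_nhds.congr' ?_
  obtain ⟨N, hN⟩ := Γ.exists_nat_subset_range
  filter_upwards [eventually_ge_atTop N] with M hM
  exact proj_subset b (hN.trans (Finset.range_mono hM)) fun n _ hn => h n hn

theorem proj_proj_of_subset (b : SchauderBasis ℝ X) {Γ Δ : Finset ℕ} (h : Γ ⊆ Δ) (x : X) :
    GeneralSchauderBasis.proj b Γ (GeneralSchauderBasis.proj b Δ x) =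
      GeneralSchauderBasis.proj b Γ x :=
  proj_congr b fun n hn => by rw [coeffs_proj, if_pos (h hn)]

theorem exists_norm_bound (b : SchauderBasis ℝ X) (hb : IsSemiNormalized b) :
    ∃ κ : ℝ, 0 < κ ∧ (∀ n, ‖b n‖ ≤ κ) ∧ ∀ x n, |coeffs b x n| ≤ κ * ‖x‖ := by
  obtain ⟨c₁, c₂, -, h2, h⟩ := hb
  refine ⟨c₂, h2, fun n => (h n).1.2, fun x n => ?_⟩
  exact ((b.coord n).le_opNorm x).trans
    (mul_le_mul_of_nonneg_right (h n).2.2 (norm_nonneg _))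

theorem norm_proj_le_card (b : SchauderBasis ℝ X) {κ r : ℝ}
    (hκb : ∀ n, ‖b n‖ ≤ κ) {x : X} {Γ : Finset ℕ} (h : ∀ n ∈ Γ, |coeffs b x n| ≤ r) :
    ‖GeneralSchauderBasis.proj b Γ x‖ ≤ Γ.card * (r * κ) := by
  rw [proj_eq_sum, ← nsmul_eq_mul]
  refine (norm_sum_le _ _).trans (Finset.sum_le_card_nsmul _ _ _ fun n hn => ?_)
  rw [norm_smul, Real.norm_eq_abs]
  exact mul_le_mul (h n hn) (hκb n) (norm_nonneg _) ((abs_nonneg _).trans (h n hn))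

theorem exists_superlevel (b : SchauderBasis ℝ X) (hb : IsSemiNormalized b) (x : X) {s : ℝ}
    (hs : 0 < s) : ∃ Γ : Finset ℕ, ∀ n, n ∈ Γ ↔ s < |coeffs b x n| := by
  have h := (tendsto_coeffs b hb x).abs
  rw [abs_zero] at h
  have h1 := h.eventually (gt_mem_nhds hs)
  obtain ⟨N, hN⟩ := eventually_atTop.mp h1
  refine ⟨(Finset.range N).filter fun n => s < |coeffs b x n|, fun n => ?_⟩
  simp only [Finset.mem_filter, Finset.mem_range, and_iff_right_iff_imp]
  intro hn
  by_contra hc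
  exact lt_asymm hn (hN n (not_lt.mp hc))

/-! ### Weak greedy sets versus threshold sets -/

/-- Fewer than `k` exceptions inside cannot pull the `k`-th smallest modulus below `t * α`, and
fewer than `l` exceptions outside cannot push the `l`-th largest above `α`. -/
theorem isWeakGreedySet_of_threshold (b : SchauderBasis ℝ X) {k l : ℕ} {t α : ℝ} {x : X}
    {Γ D E : Finset ℕ} (ht : 0 ≤ t) (hα : 0 ≤ α) (hk : k ≤ Γ.card) (hD : D.card < k)
    (hE : E.card < l) (hin : ∀ n ∈ Γ, n ∉ D → t * α ≤ |coeffs b x n|)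
    (hout : ∀ n ∉ Γ, n ∉ E → |coeffs b x n| ≤ α) : IsWeakGreedySet b k l t x Γ := by
  refine ⟨hk, ?_⟩
  have h1 : kthLargestOutside (coeffs b x) Γ l ≤ α := by
    refine Real.sSup_le (fun r hr => ?_) hα
    by_contra! hlt
    have hsub : {n : ℕ | n ∉ Γ ∧ r ≤ |coeffs b x n|} ⊆ (E : Set ℕ) := fun n hn => by
      by_contra hnE
      exact absurd (hout n hn.1 hnE) (not_le.mpr (hlt.trans_le hn.2))
    have h2 := (hr : (l : ℕ∞) ≤ _).trans (Set.encard_le_encard hsub)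
    rw [Set.encard_coe_eq_coe_finsetCard, Nat.cast_le] at h2
    omega
  refine (mul_le_mul_of_nonneg_left h1 ht).trans (le_csInf ?_ ?_)
  · obtain ⟨M, hM⟩ := (Γ.image fun n => |coeffs b x n|).exists_le
    refine ⟨M, ?_⟩
    rw [Set.mem_ofPred_eq, Finset.filter_true_of_mem]
    · exact hk
    · exact fun n hn => hM _ (Finset.mem_image_of_mem _ hn)
  · intro r hr
    by_contra! hlt
    have hsub : (Γ.filter fun n => |coeffs b x n| ≤ r) ⊆ D := fun n hn => by
      rw [Finset.mem_filter] at hn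
      by_contra hnD
      exact absurd (hin n hn.1 hnD) (not_le.mpr (hn.2.trans_lt hlt))
    have h2 := (hr : k ≤ _).trans (Finset.card_le_card hsub)
    omega

theorem IsWeakGreedySet.exists_threshold (b : SchauderBasis ℝ X) (hb : IsSemiNormalized b)
    {k l : ℕ} {t : ℝ} {x : X} {Γ : Finset ℕ} (hk : 1 ≤ k) (hl : 1 ≤ l)
    (ht1 : t ≤ 1) (h : IsWeakGreedySet b k l t x Γ) :
    ∃ (α : ℝ) (D E : Finset ℕ), 0 ≤ α ∧ D ⊆ Γ ∧ Disjoint Γ E ∧ D.card < k ∧ E.card < l ∧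
      (∀ n ∈ D, |coeffs b x n| < t * α) ∧ IsThresholdSet (coeffs b x) t α (Γ \ D ∪ E) := by
  obtain ⟨κ, hκ, -, hκc⟩ := exists_norm_bound b hb
  set α := kthLargestOutside (coeffs b x) Γ l with hαdef
  set S : Set ℝ := {r : ℝ | (l : ℕ∞) ≤ Set.encard {n : ℕ | n ∉ Γ ∧ r ≤ |coeffs b x n|}} with hS
  have hbdd : BddAbove S := by
    refine ⟨κ * ‖x‖, fun r hr => ?_⟩
    have hne : {n : ℕ | n ∉ Γ ∧ r ≤ |coeffs b x n|}.Nonempty := by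
      rw [← Set.one_le_encard_iff_nonempty]
      exact le_trans (by exact_mod_cast hl) (hr : (l : ℕ∞) ≤ _)
    obtain ⟨n, -, hn⟩ := hne
    exact hn.trans (hκc x n)
  -- The level 0 is admissible because the complement of `Γ` is infinite.
  have hα : 0 ≤ α := by
    refine le_csSup hbdd ?_
    have : {n : ℕ | n ∉ Γ ∧ 0 ≤ |coeffs b x n|} = ((Γ : Set ℕ))ᶜ := by
      ext n; simp
    rw [Set.mem_ofPred_eq, this, Set.Infinite.encard_eq Γ.finite_toSet.infinite_compl]
    exact le_top
  -- Among `l` outside coefficients exceeding `α`, the smallest modulus would itself be an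
  -- admissible level above the supremum.
  have hEfin : Set.encard {n : ℕ | n ∉ Γ ∧ α < |coeffs b x n|} < l := by
    by_contra! hge
    obtain ⟨T, hT, hTc⟩ := Set.exists_subset_encard_eq hge
    have hTf : T.Finite := Set.finite_of_encard_eq_coe hTc
    have hTne : T.Nonempty := by
      rw [← Set.one_le_encard_iff_nonempty, hTc]; exact_mod_cast hl
    obtain ⟨m, hm, hmin⟩ := Set.exists_min_image T (fun n => |coeffs b x n|) hTf hTne
    have : |coeffs b x m| ≤ α := by
      refine le_csSup hbdd ?_
      rw [Set.mem_ofPred_eq, ← hTc]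
      exact Set.encard_le_encard fun n hn => ⟨(hT hn).1, hmin n hn⟩
    exact absurd (hT hm).2 (not_lt.mpr this)
  have hEf : {n : ℕ | n ∉ Γ ∧ α < |coeffs b x n|}.Finite :=
    Set.finite_of_encard_le_coe hEfin.le
  refine ⟨α, Γ.filter fun n => |coeffs b x n| < t * α, hEf.toFinset, hα,
    Finset.filter_subset _ _, ?_, ?_, ?_, fun n hn => (Finset.mem_filter.mp hn).2, ?_, ?_⟩
  · rw [Finset.disjoint_left]
    intro n hn hn'
    exact ((Set.Finite.mem_toFinset hEf).mp hn').1 hn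
  · by_contra! hge
    have hne : (Γ.filter fun n => |coeffs b x n| < t * α).Nonempty := by
      rw [← Finset.card_pos]; omega
    obtain ⟨m, hm, hmax⟩ := Finset.exists_max_image _ (fun n => |coeffs b x n|) hne
    have hle : kthSmallestInside (coeffs b x) Γ k ≤ |coeffs b x m| := by
      refine csInf_le ⟨0, fun r hr => ?_⟩ ?_
      · have : (Γ.filter fun n => |coeffs b x n| ≤ r).Nonempty := by
          rw [← Finset.card_pos]
          exact lt_of_lt_of_le hk hr
        obtain ⟨n, hn⟩ := this
        exact (abs_nonneg _).trans (Finset.mem_filter.mp hn).2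
      · refine hge.trans (Finset.card_le_card fun n hn => ?_)
        exact Finset.mem_filter.mpr ⟨(Finset.mem_filter.mp hn).1, hmax n hn⟩
    exact absurd (h.2.trans hle) (not_le.mpr (Finset.mem_filter.mp hm).2)
  · rw [← Nat.cast_lt (α := ℕ∞), ← Set.encard_coe_eq_coe_finsetCard, Set.Finite.coe_toFinset]
    exact hEfin
  · intro n hn
    rcases Finset.mem_union.mp hn with hn | hn
    · rw [Finset.mem_sdiff, Finset.mem_filter, not_and, not_lt] at hn
      exact hn.2 hn.1
    · have := ((Set.Finite.mem_toFinset hEf).mp hn).2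
      nlinarith
  · intro n hn
    simp only [Finset.mem_union, Finset.mem_sdiff, Finset.mem_filter, Set.Finite.mem_toFinset,
      Set.mem_ofPred_eq, not_or, not_and, not_lt] at hn
    by_cases hnΓ : n ∈ Γ
    · by_contra! hc
      exact hn.1 hnΓ fun _ => by nlinarith
    · exact hn.2 hnΓ

/-! ### Convergence of threshold projections -/

theorem tendsto_proj_of_thresholdBound (b : SchauderBasis ℝ X) {t C : ℝ}
    (hC : ThresholdBound b t C) (x : X) (α : ℕ → ℝ) (Γ : ℕ → Finset ℕ)
    (hα : Tendsto α atTop (𝓝 0))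
    (hΓ : ∀ᶠ m in atTop, 0 ≤ α m ∧ IsThresholdSet (coeffs b x) t (α m) (Γ m)) :
    Tendsto (fun m => GeneralSchauderBasis.proj b (Γ m) x) atTop (𝓝 x) := by
  rw [Metric.tendsto_atTop']
  intro ε hε
  have hC1 : 0 < 1 + |C| := by positivity
  obtain ⟨N, hN⟩ := ((Metric.tendsto_atTop.mp (b.tendsto_proj x)) (ε / (1 + |C|))
    (by positivity))
  have hN := hN N le_rfl
  set y := x - b.proj N x with hy
  have hynorm : (1 + |C|) * ‖y‖ < ε := by
    rw [dist_comm, dist_eq_norm, lt_div_iff₀ hC1] at hN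
    linarith
  have hyc : ∀ n, coeffs b y n = if n < N then 0 else coeffs b x n := by
    intro n
    rw [hy, coeffs_sub, SchauderBasis.proj, coeffs_proj]
    simp only [Finset.mem_range]
    split_ifs <;> simp
  have hsmall : ∀ᶠ m in atTop, ∀ n ∈ Finset.range N, coeffs b x n ≠ 0 →
      α m < |coeffs b x n| := by
    refine (Filter.eventually_all_finset _).mpr fun n _ => ?_
    by_cases h0 : coeffs b x n = 0
    · simp [h0]
    · filter_upwards [hα.eventually (gt_mem_nhds (abs_pos.mpr h0))] with m hm _ using hm
  obtain ⟨M, hM⟩ := eventually_atTop.mp (hsmall.and hΓ)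
  refine ⟨M, fun m hm => ?_⟩
  obtain ⟨hs, hα0, hin, hout⟩ := hM m hm.le
  set Δ := (Γ m).filter fun n => N ≤ n with hΔ
  -- Erasing the head of both vector and set preserves the threshold property, so the error is
  -- controlled by the small tail `y`.
  have hbd : ‖GeneralSchauderBasis.proj b Δ y‖ ≤ C * ‖y‖ := by
    refine hC y (α m) Δ hα0 ⟨fun n hn => ?_, fun n hn => ?_⟩
    · rw [hΔ, Finset.mem_filter] at hn
      rw [hyc, if_neg (not_lt.mpr hn.2)]
      exact hin n hn.1
    · rw [hyc]
      split_ifs with h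
      · simpa using hα0
      · refine hout n fun hn' => hn ?_
        exact Finset.mem_filter.mpr ⟨hn', not_lt.mp h⟩
  have hzero : GeneralSchauderBasis.proj b (Γ m) x = b.proj N x +
      GeneralSchauderBasis.proj b Δ y := by
    -- Once `α m` lies below every nonzero head coefficient, `Γ m` can omit only zero terms of the
    -- head.
    have h1 : GeneralSchauderBasis.proj b ((Γ m).filter fun n => ¬ N ≤ n) x = b.proj N x := by
      refine proj_subset b (fun n hn => ?_) fun n hn hn' => ?_
      · rw [Finset.mem_filter] at hn
        exact Finset.mem_range.mpr (not_le.mp hn.2)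
      · by_contra h0
        refine hn' (Finset.mem_filter.mpr ⟨?_, not_le.mpr (Finset.mem_range.mp hn)⟩)
        by_contra hnΓ
        exact absurd (hs n hn h0) (not_lt.mpr (hout n hnΓ))
    have h2 : GeneralSchauderBasis.proj b Δ y = GeneralSchauderBasis.proj b Δ x :=
      proj_congr b fun n hn => by
        rw [hyc, if_neg (not_lt.mpr (Finset.mem_filter.mp hn).2)]
    rw [h2, ← h1, ← proj_union b (Finset.disjoint_filter_filter_not _ _ _).symm, Finset.union_comm,
      Finset.filter_union_filter_not_eq]
  rw [dist_comm, dist_eq_norm, hzero, ← sub_sub, ← hy]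
  calc ‖y - GeneralSchauderBasis.proj b Δ y‖ ≤ ‖y‖ + C * ‖y‖ :=
        (norm_sub_le _ _).trans (by gcongr)
    _ ≤ (1 + |C|) * ‖y‖ := by
        have := mul_le_mul_of_nonneg_right (le_abs_self C) (norm_nonneg y)
        linarith
    _ < ε := hynorm

theorem IsGreedyOrdering.abs_le {c : ℕ → ℝ} {ρ : ℕ → ℕ} (h : IsGreedyOrdering c ρ) {j k : ℕ}
    (hjk : j ≤ k) : |c (ρ k)| ≤ |c (ρ j)| := by
  rcases hjk.eq_or_lt with rfl | hlt
  · exact le_rfl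
  · rcases h.2.2 j k hlt with h | h
    · exact h.le
    · exact h.1.ge

theorem greedySum_eq_proj (b : SchauderBasis ℝ X) {ρ : ℕ → ℕ} (hρ : Function.Injective ρ)
    (m : ℕ) (x : X) :
    greedySum b ρ m x = GeneralSchauderBasis.proj b ((Finset.range m).image ρ) x := by
  rw [proj_eq_sum, Finset.sum_image fun i _ j _ hij => hρ hij]
  rfl

theorem IsGreedyOrdering.isThresholdSet {c : ℕ → ℝ} {ρ : ℕ → ℕ} (h : IsGreedyOrdering c ρ)
    (m : ℕ) : IsThresholdSet c 1 |c (ρ m)| ((Finset.range m).image ρ) := by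
  refine ⟨fun n hn => ?_, fun n hn => ?_⟩
  · obtain ⟨j, hj, rfl⟩ := Finset.mem_image.mp hn
    rw [one_mul]
    exact h.abs_le (Finset.mem_range.mp hj).le
  · by_cases h0 : c n = 0
    · simp [h0]
    · obtain ⟨j, rfl⟩ := h.2.1 (Function.mem_support.mpr h0)
      refine h.abs_le ?_
      by_contra! hlt
      exact hn (Finset.mem_image_of_mem _ (Finset.mem_range.mpr hlt))

theorem IsGreedyOrdering.tendsto_abs {c : ℕ → ℝ} {ρ : ℕ → ℕ} (h : IsGreedyOrdering c ρ)
    (hc : Tendsto c atTop (𝓝 0)) : Tendsto (fun m => |c (ρ m)|) atTop (𝓝 0) := by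
  have := (hc.comp h.1.nat_tendsto_atTop).abs
  simpa using this

/-! ### Baire category bound for superlevel projections -/

/-- The vectors whose superlevel projections are all bounded by `K`. -/
def superlevelBounded (b : SchauderBasis ℝ X) (K : ℝ) : Set X :=
  {x | ∀ (s : ℝ) (Γ : Finset ℕ), 0 < s → (∀ n, n ∈ Γ ↔ s < |coeffs b x n|) →
    ‖GeneralSchauderBasis.proj b Γ x‖ ≤ K}

theorem isClosed_superlevelBounded (b : SchauderBasis ℝ X) (hb : IsSemiNormalized b) (K : ℝ) :
    IsClosed (superlevelBounded b K) := by
  obtain ⟨κ, hκ, -, hκc⟩ := exists_norm_bound b hb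
  rw [← isOpen_compl_iff, isOpen_iff_eventually]
  intro x hx
  simp only [superlevelBounded, Set.mem_compl_iff, Set.mem_ofPred_eq, not_forall, not_le] at hx
  obtain ⟨s, Γ, hs, hΓ, hK⟩ := hx
  -- Finiteness of `Γ` leaves a gap above `s`; level `s + δ` then cuts out the same set `Γ` for all
  -- vectors whose coefficients are within `δ` of those of `x`.
  have hδ : ∀ᶠ δ in 𝓝[>] (0 : ℝ), ∀ n ∈ Γ, s + 2 * δ < |coeffs b x n| := by
    refine (Filter.eventually_all_finset _).mpr fun n hn => ?_
    have hcont : Tendsto (fun δ : ℝ => s + 2 * δ) (𝓝[>] 0) (𝓝 s) := by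
      have : Continuous fun δ : ℝ => s + 2 * δ := by fun_prop
      simpa using (this.tendsto 0).mono_left nhdsWithin_le_nhds
    exact hcont.eventually (gt_mem_nhds ((hΓ n).mp hn))
  obtain ⟨δ, hδ, hδ0⟩ := (hδ.and self_mem_nhdsWithin).exists
  replace hδ0 : 0 < δ := hδ0
  have h1 : ∀ᶠ y in 𝓝 x, K < ‖GeneralSchauderBasis.proj b Γ y‖ :=
    ((GeneralSchauderBasis.proj b Γ).continuous.norm.tendsto x).eventually (lt_mem_nhds hK)
  have h2 : ∀ᶠ y in 𝓝 x, ‖y - x‖ < δ / κ := by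
    filter_upwards [Metric.ball_mem_nhds x (div_pos hδ0 hκ)] with y hy
    rwa [← dist_eq_norm]
  filter_upwards [h1, h2] with y hy1 hy2 hy
  have hclose : ∀ n, |(|coeffs b y n| - |coeffs b x n|)| < δ := by
    intro n
    refine (abs_abs_sub_abs_le_abs_sub _ _).trans_lt ?_
    rw [← coeffs_sub]
    refine (hκc _ _).trans_lt ?_
    rwa [lt_div_iff₀ hκ, mul_comm] at hy2
  refine absurd (hy (s + δ) Γ (by linarith) fun n => ⟨fun hn => ?_, fun hn => ?_⟩)
    (not_le.mpr hy1)
  · have := abs_lt.mp (hclose n)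
    have := hδ n hn
    linarith
  · have := abs_lt.mp (hclose n)
    exact (hΓ n).mpr (by linarith)

/-- Strict superlevel sets are initial segments of a greedy ordering, and convergent greedy sums are
bounded. -/
theorem exists_mem_superlevelBounded (b : SchauderBasis ℝ X) (hb : IsSemiNormalized b)
    (hq : IsQuasiGreedy b) (x : X) : ∃ K : ℕ, x ∈ superlevelBounded b K := by
  obtain ⟨ρ, hρ⟩ := exists_isGreedyOrdering_coeffs b hb x
  obtain ⟨M, hM⟩ := (hq x ρ hρ).norm.bddAbove_range
  obtain ⟨K, hK⟩ := exists_nat_ge M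
  refine ⟨K, fun s Γ hs hΓ => ?_⟩
  have hex : ∃ m, |coeffs b x (ρ m)| ≤ s :=
    (((hρ.tendsto_abs (tendsto_coeffs b hb x)).eventually (gt_mem_nhds hs)).exists).imp
      fun m hm => hm.le
  classical
  have hEq : Γ = (Finset.range (Nat.find hex)).image ρ := by
    ext n
    rw [hΓ]
    refine ⟨fun hn => ?_, fun hn => ?_⟩
    · have h0 : coeffs b x n ≠ 0 := abs_pos.mp (hs.trans hn)
      obtain ⟨j, rfl⟩ := hρ.2.1 (Function.mem_support.mpr h0)
      refine Finset.mem_image_of_mem _ (Finset.mem_range.mpr ?_)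
      by_contra! hle
      exact absurd ((hρ.abs_le hle).trans (Nat.find_spec hex)) (not_le.mpr hn)
    · obtain ⟨j, hj, rfl⟩ := Finset.mem_image.mp hn
      exact not_le.mp (Nat.find_min hex (Finset.mem_range.mp hj))
  rw [hEq, ← greedySum_eq_proj b hρ.1]
  exact (hM ⟨_, rfl⟩).trans hK

/-- A quasi-greedy basis has a tail on which the superlevel projections are bounded. -/
theorem IsQuasiGreedy.exists_tail_bound [CompleteSpace X] (b : SchauderBasis ℝ X)
    (hb : IsSemiNormalized b) (hq : IsQuasiGreedy b) :
    ∃ (C : ℝ) (N : ℕ), 0 ≤ C ∧ ∀ (y : X) (s : ℝ) (Γ : Finset ℕ), 0 < s →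
      (∀ n < N, coeffs b y n = 0) → (∀ n, n ∈ Γ ↔ s < |coeffs b y n|) →
      ‖GeneralSchauderBasis.proj b Γ y‖ ≤ C * ‖y‖ := by
  obtain ⟨K, x₀, hx₀⟩ := nonempty_interior_of_iUnion_of_closed
    (f := fun K : ℕ => superlevelBounded b K) (fun K => isClosed_superlevelBounded b hb K)
    (Set.eq_univ_of_forall fun x => Set.mem_iUnion.mpr (exists_mem_superlevelBounded b hb hq x))
  obtain ⟨N, hN⟩ := ((b.tendsto_proj x₀).eventually (isOpen_interior.mem_nhds hx₀)).exists
  -- A finitely supported centre has support disjoint from that of any tail vector `y`, so the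
  -- superlevel set of `u + y` splits into those of `u` and `y`.
  set u := b.proj N x₀ with hu
  have huc : ∀ n, coeffs b u n = if n < N then coeffs b x₀ n else 0 := fun n => by
    rw [hu, SchauderBasis.proj, coeffs_proj]; simp only [Finset.mem_range]
  have huK : u ∈ superlevelBounded b K := interior_subset hN
  obtain ⟨r, hr, hball⟩ := Metric.mem_nhds_iff.mp (mem_interior_iff_mem_nhds.mp hN)
  have hsmall : ∀ (y : X) (s : ℝ) (Γ : Finset ℕ), 0 < s → ‖y‖ < r →
      (∀ n < N, coeffs b y n = 0) → (∀ n, n ∈ Γ ↔ s < |coeffs b y n|) →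
      ‖GeneralSchauderBasis.proj b Γ y‖ ≤ 2 * K := by
    intro y s Γ hs hy hy0 hΓ
    obtain ⟨H, hH⟩ := exists_superlevel b hb u hs
    have hΓN : ∀ n ∈ Γ, N ≤ n := fun n hn => by
      by_contra! hlt
      have := (hΓ n).mp hn
      rw [hy0 n hlt, abs_zero] at this
      exact lt_asymm hs this
    have hHN : ∀ n ∈ H, n < N := fun n hn => by
      by_contra! hle
      have := (hH n).mp hn
      rw [huc, if_neg (not_lt.mpr hle), abs_zero] at this
      exact lt_asymm hs this
    have hdisj : Disjoint Γ H := Finset.disjoint_left.mpr fun n hn hn' =>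
      absurd (hHN n hn') (not_lt.mpr (hΓN n hn))
    have hsum : ‖GeneralSchauderBasis.proj b (Γ ∪ H) (u + y)‖ ≤ K := by
      refine hball ?_ s _ hs fun n => ?_
      · simpa using hy
      · rw [Finset.mem_union, hΓ, hH, coeffs_add]
        rcases lt_or_ge n N with h | h
        · simp [hy0 n h, hs.le]
        · rw [huc, if_neg (not_lt.mpr h)]
          simp [hs.le]
    have hΓu : GeneralSchauderBasis.proj b Γ (u + y) = GeneralSchauderBasis.proj b Γ y :=
      proj_congr b fun n hn => by
        rw [coeffs_add, huc, if_neg (not_lt.mpr (hΓN n hn)), zero_add]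
    have hHy : GeneralSchauderBasis.proj b H (u + y) = GeneralSchauderBasis.proj b H u :=
      proj_congr b fun n hn => by rw [coeffs_add, hy0 n (hHN n hn), add_zero]
    rw [proj_union b hdisj, hΓu, hHy] at hsum
    have hHu := huK s H hs hH
    calc ‖GeneralSchauderBasis.proj b Γ y‖
        = ‖(GeneralSchauderBasis.proj b Γ y + GeneralSchauderBasis.proj b H u) -
            GeneralSchauderBasis.proj b H u‖ := by rw [add_sub_cancel_right]
      _ ≤ K + K := (norm_sub_le _ _).trans (add_le_add hsum hHu)
      _ = 2 * K := by ring
  -- The factor 4 comes from the bound `2 * K` after rescaling `y` to norm `r / 2`.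
  refine ⟨4 * K / r, N, by positivity, fun y s Γ hs hy0 hΓ => ?_⟩
  rcases eq_or_ne y 0 with rfl | hy
  · simp
  have hyp : 0 < ‖y‖ := norm_pos_iff.mpr hy
  set a := r / (2 * ‖y‖) with ha
  have hapos : 0 < a := by positivity
  have h := hsmall (a • y) (a * s) Γ (by positivity) ?_ ?_ ?_
  · rw [map_smul, norm_smul, Real.norm_of_nonneg hapos.le, ← le_div_iff₀' hapos] at h
    refine h.trans_eq ?_
    rw [ha]; field_simp; ring
  · rw [norm_smul, Real.norm_of_nonneg hapos.le, ha]
    field_simp; linarith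
  · intro n hn; rw [coeffs_smul, hy0 n hn, mul_zero]
  · intro n
    rw [hΓ, coeffs_smul, abs_mul, abs_of_pos hapos, mul_lt_mul_iff_right₀ hapos]

theorem IsQuasiGreedy.exists_superlevelBound [CompleteSpace X] (b : SchauderBasis ℝ X)
    (hb : IsSemiNormalized b) (hq : IsQuasiGreedy b) : ∃ C, 1 ≤ C ∧ SuperlevelBound b C := by
  obtain ⟨κ, hκ, hκb, hκc⟩ := exists_norm_bound b hb
  obtain ⟨C, N, hC, hbd⟩ := hq.exists_tail_bound b hb
  refine ⟨1 + (C * (1 + N * (κ * κ)) + N * (κ * κ)), ?_, fun x s Γ hs hΓ => ?_⟩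
  · have : 0 ≤ C * (1 + N * (κ * κ)) + N * (κ * κ) := by positivity
    linarith
  have hhead : ∀ H : Finset ℕ, H ⊆ Finset.range N →
      ‖GeneralSchauderBasis.proj b H x‖ ≤ N * (κ * κ) * ‖x‖ := by
    intro H hH
    refine (norm_proj_le_card b hκb fun n _ => hκc x n).trans ?_
    have h1 : (H.card : ℝ) ≤ N := by
      exact_mod_cast (Finset.card_le_card hH).trans (Finset.card_range N).le
    calc (H.card : ℝ) * (κ * ‖x‖ * κ) ≤ N * (κ * ‖x‖ * κ) := by gcongr
      _ = _ := by ring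
  set y := x - b.proj N x with hy
  have hyc : ∀ n, coeffs b y n = if n < N then 0 else coeffs b x n := by
    intro n
    rw [hy, coeffs_sub, SchauderBasis.proj, coeffs_proj]
    simp only [Finset.mem_range]
    split_ifs <;> simp
  have hynorm : ‖y‖ ≤ (1 + N * (κ * κ)) * ‖x‖ := by
    have := (norm_sub_le x (b.proj N x)).trans (add_le_add le_rfl (hhead _ subset_rfl))
    linarith
  have h1 : ‖GeneralSchauderBasis.proj b (Γ.filter fun n => N ≤ n) y‖ ≤ C * ‖y‖ := by
    refine hbd y s _ hs (fun n hn => by rw [hyc, if_pos hn]) fun n => ?_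
    rw [Finset.mem_filter, hΓ, hyc]
    split_ifs with h
    · simp [not_le.mpr h, hs.le]
    · simp [not_lt.mp h]
  have h2 : GeneralSchauderBasis.proj b (Γ.filter fun n => N ≤ n) y =
      GeneralSchauderBasis.proj b (Γ.filter fun n => N ≤ n) x :=
    proj_congr b fun n hn => by
      rw [hyc, if_neg (not_lt.mpr (Finset.mem_filter.mp hn).2)]
  have h3 := hhead (Γ.filter fun n => ¬ N ≤ n) fun n hn =>
    Finset.mem_range.mpr (not_le.mp (Finset.mem_filter.mp hn).2)
  rw [h2] at h1
  have h4 : GeneralSchauderBasis.proj b Γ x =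
      GeneralSchauderBasis.proj b (Γ.filter fun n => N ≤ n) x +
      GeneralSchauderBasis.proj b (Γ.filter fun n => ¬ N ≤ n) x := by
    rw [← proj_union b (Finset.disjoint_filter_filter_not _ _ _), Finset.filter_union_filter_not_eq]
  rw [h4]
  have h5 := mul_le_mul_of_nonneg_left hynorm hC
  have := (norm_add_le _ _).trans (add_le_add h1 h3)
  nlinarith [norm_nonneg x]

/-! ### From superlevel sets to threshold sets -/

/-- Projections onto arbitrary parts of a thin layer of coefficients are bounded. -/
theorem SuperlevelBound.norm_proj_layer_le (b : SchauderBasis ℝ X) (hb : IsSemiNormalized b)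
    {C : ℝ} (hC1 : 1 ≤ C) (hC : SuperlevelBound b C) {x : X} {β : ℝ} (hβ : 0 < β)
    {D : Finset ℕ} (hlow : ∀ n ∈ D, β < (1 + 1 / (2 * C)) * |coeffs b x n|)
    (hup : ∀ n ∈ D, |coeffs b x n| ≤ β) :
    ‖GeneralSchauderBasis.proj b D x‖ ≤ 4 * C * ‖x‖ := by
  set δ := 1 / (2 * C) with hδ
  have hδ0 : 0 < δ := by positivity
  -- This choice of `δ` lets the term `C * δ * ‖P_D x‖`, created by the perturbation `z`, be
  -- absorbed on the left.
  have hCδ : C * δ = 1 / 2 := by rw [hδ]; field_simp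
  obtain ⟨G, hG⟩ := exists_superlevel b hb x hβ
  have hdisj : Disjoint G D := Finset.disjoint_left.mpr fun n hn hn' =>
    absurd (hup n hn') (not_le.mpr ((hG n).mp hn))
  set z := x + δ • GeneralSchauderBasis.proj b D x with hz
  have hzc : ∀ n, coeffs b z n = if n ∈ D then (1 + δ) * coeffs b x n else coeffs b x n := by
    intro n
    rw [hz, coeffs_add, coeffs_smul, coeffs_proj]
    split_ifs <;> ring
  -- Multiplication by `1 + δ` lifts exactly the coefficients in `D` across level `β`.
  have h1 : ‖GeneralSchauderBasis.proj b (G ∪ D) z‖ ≤ C * ‖z‖ := by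
    refine hC z β _ hβ fun n => ?_
    rw [Finset.mem_union, hzc, hG]
    split_ifs with h
    · rw [abs_mul, abs_of_pos (by linarith : 0 < 1 + δ)]
      simp [h, hlow n h]
    · simp [h]
  have h2 : GeneralSchauderBasis.proj b (G ∪ D) z = GeneralSchauderBasis.proj b G x +
      (1 + δ) • GeneralSchauderBasis.proj b D x := by
    rw [proj_union b hdisj]
    congr 1
    · exact proj_congr b fun n hn => by
        rw [hzc, if_neg (Finset.disjoint_left.mp hdisj hn)]
    · rw [← map_smul]
      exact proj_congr b fun n hn => by rw [hzc, if_pos hn, coeffs_smul]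
  have h3 := hC x β G hβ hG
  have h4 : ‖z‖ ≤ ‖x‖ + δ * ‖GeneralSchauderBasis.proj b D x‖ := by
    refine (norm_add_le _ _).trans_eq ?_
    rw [norm_smul, Real.norm_of_nonneg hδ0.le]
  have h5 : (1 + δ) * ‖GeneralSchauderBasis.proj b D x‖ ≤ C * ‖z‖ + C * ‖x‖ := by
    rw [← Real.norm_of_nonneg (by linarith : 0 ≤ 1 + δ), ← norm_smul,
      ← add_sub_cancel_left (GeneralSchauderBasis.proj b G x)
        ((1 + δ) • GeneralSchauderBasis.proj b D x), ← h2]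
    exact (norm_sub_le _ _).trans (add_le_add h1 h3)
  have h6 := mul_le_mul_of_nonneg_left h4 (by linarith : 0 ≤ C)
  have h7 : C * (‖x‖ + δ * ‖GeneralSchauderBasis.proj b D x‖) =
      C * ‖x‖ + 1 / 2 * ‖GeneralSchauderBasis.proj b D x‖ := by rw [← hCδ]; ring
  have h8 := mul_nonneg hδ0.le (norm_nonneg (GeneralSchauderBasis.proj b D x))
  linarith

/-- Each induction step peels off the lowest layer, of ratio `1 + 1 / (2 * C)`, until only a strict
superlevel set remains. -/
theorem SuperlevelBound.norm_proj_le_of_layers (b : SchauderBasis ℝ X)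
    (hb : IsSemiNormalized b) {C : ℝ} (hC1 : 1 ≤ C) (hC : SuperlevelBound b C) (x : X) {α : ℝ}
    (hα : 0 < α) (K : ℕ) (Γ : Finset ℕ)
    (hin : ∀ n ∈ Γ, α < (1 + 1 / (2 * C)) ^ K * |coeffs b x n|)
    (hout : ∀ n ∉ Γ, |coeffs b x n| ≤ α) :
    ‖GeneralSchauderBasis.proj b Γ x‖ ≤ (C + 4 * C * K) * ‖x‖ := by
  set r := 1 + 1 / (2 * C) with hr
  have hr1 : 1 ≤ r := by
    have : 0 ≤ 1 / (2 * C) := by positivity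
    linarith
  induction K generalizing Γ with
  | zero =>
    simp only [pow_zero, one_mul] at hin
    have := hC x α Γ hα fun n =>
      ⟨hin n, fun h => by_contra fun hn => absurd (hout n hn) (not_le.mpr h)⟩
    simpa using this
  | succ K ih =>
    have hrK : 0 < r ^ K := by positivity
    have h1 := ih (Γ.filter fun n => α < r ^ K * |coeffs b x n|)
      (hin := fun n hn => (Finset.mem_filter.mp hn).2) (hout := fun n hn => by
        by_cases hnΓ : n ∈ Γ
        · have h : r ^ K * |coeffs b x n| ≤ α :=
            not_lt.mp fun h => hn (Finset.mem_filter.mpr ⟨hnΓ, h⟩)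
          exact (le_mul_of_one_le_left (abs_nonneg _) (one_le_pow₀ hr1)).trans h
        · exact hout n hnΓ)
    have h2 : ‖GeneralSchauderBasis.proj b
        (Γ.filter fun n => ¬ α < r ^ K * |coeffs b x n|) x‖ ≤ 4 * C * ‖x‖ := by
      refine hC.norm_proj_layer_le b hb hC1 (β := α / r ^ K) (by positivity)
        (fun n hn => ?_) fun n hn => ?_
      · have := hin n (Finset.mem_filter.mp hn).1
        rw [div_lt_iff₀ hrK]
        rw [pow_succ] at this
        linarith
      · have := not_lt.mp (Finset.mem_filter.mp hn).2
        rwa [le_div_iff₀' hrK]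
    rw [← Finset.filter_union_filter_not_eq (fun n => α < r ^ K * |coeffs b x n|) Γ,
      proj_union b (Finset.disjoint_filter_filter_not _ _ _)]
    refine (norm_add_le _ _).trans ((add_le_add h1 h2).trans_eq ?_)
    push_cast
    ring

theorem SuperlevelBound.exists_thresholdBound (b : SchauderBasis ℝ X) (hb : IsSemiNormalized b)
    {C : ℝ} (hC1 : 1 ≤ C) (hC : SuperlevelBound b C) {t : ℝ} (ht : 0 < t) :
    ∃ C', 0 ≤ C' ∧ ThresholdBound b t C' := by
  have hr1 : 1 < 1 + 1 / (2 * C) := by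
    have : 0 < 1 / (2 * C) := by positivity
    linarith
  obtain ⟨K, hK⟩ := pow_unbounded_of_one_lt t⁻¹ hr1
  refine ⟨C + 4 * C * K, by positivity, fun x α Γ hα hΓ => ?_⟩
  -- At `α = 0` no positive level is available, but then `Γ` contains the whole support of `x`.
  rcases hα.eq_or_lt with rfl | hα
  · rw [proj_eq_self b fun n hn => abs_nonpos_iff.mp (hΓ.2 n hn)]
    have : 1 ≤ C + 4 * C * K := by
      have : 0 ≤ 4 * C * K := by positivity
      linarith
    exact le_mul_of_one_le_left (norm_nonneg _) this
  · refine hC.norm_proj_le_of_layers b hb hC1 x hα K Γ (fun n hn => ?_) hΓ.2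
    rw [inv_lt_iff_one_lt_mul₀ ht] at hK
    calc α < α * (t * (1 + 1 / (2 * C)) ^ K) := lt_mul_of_one_lt_right hα (by linarith)
      _ = (1 + 1 / (2 * C)) ^ K * (t * α) := by ring
      _ ≤ _ := mul_le_mul_of_nonneg_left (hΓ.1 n hn) (by positivity)

/-! ### Finite index sets: boundedness and convergence -/

/-- Threshold sets with at least `k` elements are weak greedy; smaller ones are estimated term by
term. -/
theorem HasQuasiGreedyProperty.exists_thresholdBound (b : SchauderBasis ℝ X)
    (hb : IsSemiNormalized b) {A B : Set ℕ} {t : ℝ} (ht0 : 0 < t) (ht1 : t ≤ 1)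
    (hA : A.Nonempty) (hB : B.Nonempty) (hApos : ∀ k ∈ A, 1 ≤ k) (hBpos : ∀ l ∈ B, 1 ≤ l)
    (h : HasQuasiGreedyProperty b A B t) : ∃ C, ThresholdBound b 1 C := by
  obtain ⟨κ, hκ, hκb, hκc⟩ := exists_norm_bound b hb
  obtain ⟨C, hC, hbd⟩ := h
  obtain ⟨k, hk⟩ := hA
  obtain ⟨l, hl⟩ := hB
  refine ⟨C + k * (κ * κ), fun x α Γ hα hΓ => ?_⟩
  rw [add_mul]
  rcases le_or_gt k Γ.card with hkΓ | hkΓ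
  · have hw : IsWeakGreedySet b k l t x Γ :=
      isWeakGreedySet_of_threshold b (D := ∅) (E := ∅) ht0.le hα hkΓ (hApos k hk) (hBpos l hl)
        (fun n hn _ => (mul_le_mul_of_nonneg_right ht1 hα).trans (hΓ.1 n hn))
        fun n hn _ => hΓ.2 n hn
    have := hbd k hk l hl x Γ hw
    have h0 : 0 ≤ k * (κ * κ) * ‖x‖ := by positivity
    linarith
  · have := norm_proj_le_card b hκb (Γ := Γ) fun n _ => hκc x n
    have h1 : (Γ.card : ℝ) ≤ k := by exact_mod_cast hkΓ.le
    have h2 : 0 ≤ C * ‖x‖ := by positivity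
    calc _ ≤ (Γ.card : ℝ) * (κ * ‖x‖ * κ) := this
      _ ≤ k * (κ * ‖x‖ * κ) := by gcongr
      _ = k * (κ * κ) * ‖x‖ := by ring
      _ ≤ _ := by linarith

theorem ThresholdBound.isQuasiGreedy (b : SchauderBasis ℝ X) (hb : IsSemiNormalized b) {C : ℝ}
    (h : ThresholdBound b 1 C) : IsQuasiGreedy b := by
  intro x ρ hρ
  simp_rw [greedySum_eq_proj b hρ.1]
  exact tendsto_proj_of_thresholdBound b h x _ _ (hρ.tendsto_abs (tendsto_coeffs b hb x))
    (Eventually.of_forall fun m => ⟨abs_nonneg _, hρ.isThresholdSet m⟩)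

theorem ThresholdBound.hasQuasiGreedyProperty (b : SchauderBasis ℝ X)
    (hb : IsSemiNormalized b) {A B : Set ℕ} {t C : ℝ} (ht1 : t ≤ 1)
    (hfin : (A ∪ B).Finite) (hApos : ∀ k ∈ A, 1 ≤ k) (hBpos : ∀ l ∈ B, 1 ≤ l) (hC0 : 0 ≤ C)
    (hC : ThresholdBound b t C) : HasQuasiGreedyProperty b A B t := by
  obtain ⟨κ, hκ, hκb, hκc⟩ := exists_norm_bound b hb
  obtain ⟨M, hM⟩ := hfin.bddAbove
  refine ⟨C + 2 * M * (κ * κ) + 1, by positivity, fun k hk l hl x Γ hΓ => ?_⟩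
  obtain ⟨α, D, E, hα, hDΓ, hΓE, hD, hE, -, hthr⟩ :=
    hΓ.exists_threshold b hb (hApos k hk) (hBpos l hl) ht1
  have hsmall : ∀ F : Finset ℕ, F.card ≤ M →
      ‖GeneralSchauderBasis.proj b F x‖ ≤ M * (κ * κ) * ‖x‖ := by
    intro F hF
    have h1 : (F.card : ℝ) ≤ M := by exact_mod_cast hF
    calc _ ≤ (F.card : ℝ) * (κ * ‖x‖ * κ) := norm_proj_le_card b hκb fun n _ => hκc x n
      _ ≤ M * (κ * ‖x‖ * κ) := by gcongr
      _ = _ := by ring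
  have h1 := hC x α _ hα hthr
  have h2 := hsmall D (hD.le.trans (hM (Or.inl hk)))
  have h3 := hsmall E (hE.le.trans (hM (Or.inr hl)))
  have h4 : GeneralSchauderBasis.proj b Γ x = GeneralSchauderBasis.proj b (Γ \ D ∪ E) x -
      GeneralSchauderBasis.proj b E x + GeneralSchauderBasis.proj b D x := by
    rw [proj_union b (Finset.disjoint_of_subset_left Finset.sdiff_subset hΓE),
      add_sub_cancel_right, ← proj_union b Finset.sdiff_disjoint,
      Finset.sdiff_union_of_subset hDΓ]
  rw [h4]
  have := (norm_add_le _ _).trans (add_le_add ((norm_sub_le _ _).trans (add_le_add h1 h3)) h2)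
  linarith [norm_nonneg x]

theorem ThresholdBound.weakGreedyConverges (b : SchauderBasis ℝ X)
    (hb : IsSemiNormalized b) {A : Set ℕ} {t C : ℝ} (ht0 : 0 < t) (ht1 : t ≤ 1)
    (hfin : A.Finite) (hApos : ∀ k ∈ A, 1 ≤ k) (hC : ThresholdBound b t C) :
    WeakGreedyConverges b A t := by
  obtain ⟨κ, hκ, hκb, -⟩ := exists_norm_bound b hb
  obtain ⟨M, hM⟩ := hfin.bddAbove
  intro x a Γ h
  replace h := fun m (hm : M ≤ m) => h m fun k hk => (hM hk).trans hm
  have hthr : ∀ m, M ≤ m → ∃ (α : ℝ) (D : Finset ℕ), 0 ≤ α ∧ D ⊆ Γ m ∧ D.card < M ∧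
      (∀ n ∈ D, |coeffs b x n| ≤ t * α) ∧ IsThresholdSet (coeffs b x) t α (Γ m \ D) := by
    intro m hm
    obtain ⟨ha, -, hw⟩ := h m hm
    obtain ⟨α, D, E, hα, hDΓ, -, hD, hE, hDt, hthr⟩ :=
      hw.exists_threshold b hb (hApos _ ha) le_rfl ht1
    rw [Nat.lt_one_iff, Finset.card_eq_zero] at hE
    rw [hE, Finset.union_empty] at hthr
    exact ⟨α, D, hα, hDΓ, hD.trans_le (hM ha), fun n hn => (hDt n hn).le, hthr⟩
  choose! α D hα hDΓ hDM hDt hthr using hthr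
  -- Only finitely many coefficients exceed `t * (ε / 2)`; when `Γ m \ D m` has more elements than
  -- that, one of its coefficients forces `α m ≤ ε / 2`.
  have hα0 : Tendsto α atTop (𝓝 0) := by
    rw [Metric.tendsto_atTop]
    intro ε hε
    obtain ⟨G, hG⟩ := exists_superlevel b hb x (s := t * (ε / 2)) (by positivity)
    refine ⟨M + G.card, fun m hm => ?_⟩
    have hmM : M ≤ m := by omega
    have hcard : G.card < (Γ m \ D m).card := by
      rw [Finset.card_sdiff_of_subset (hDΓ m hmM), (h m hmM).2.1]
      have := hDM m hmM
      omega
    obtain ⟨n, hn, hnG⟩ := Finset.exists_mem_notMem_of_card_lt_card hcard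
    have h1 := ((hthr m hmM).1 n hn).trans (not_lt.mp (mt (hG n).mpr hnG))
    have h2 := le_of_mul_le_mul_left h1 ht0
    rw [Real.dist_eq, sub_zero, abs_of_nonneg (hα m hmM)]
    linarith
  have hmain := tendsto_proj_of_thresholdBound b hC x α (fun m => Γ m \ D m) hα0
    (eventually_atTop.mpr ⟨M, fun m hm => ⟨hα m hm, hthr m hm⟩⟩)
  -- Fewer than `M` terms were deleted, each with coefficient at most `t * α m` in modulus.
  have hrest : Tendsto (fun m => GeneralSchauderBasis.proj b (D m) x) atTop (𝓝 0) := by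
    have hlim : Tendsto (fun m => M * (t * α m * κ)) atTop (𝓝 0) := by
      simpa using ((hα0.const_mul t).mul_const κ).const_mul (M : ℝ)
    refine squeeze_zero_norm' ?_ hlim
    filter_upwards [eventually_ge_atTop M] with m hm
    have h1 : ((D m).card : ℝ) ≤ M := by exact_mod_cast (hDM m hm).le
    have := hα m hm
    exact (norm_proj_le_card b hκb (hDt m hm)).trans (by gcongr)
  have := hmain.add hrest
  rw [add_zero] at this
  refine this.congr' ?_
  filter_upwards [eventually_ge_atTop M] with m hm
  rw [← proj_union b Finset.sdiff_disjoint, Finset.sdiff_union_of_subset (hDΓ m hm)]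

theorem WeakGreedyConverges.isQuasiGreedy (b : SchauderBasis ℝ X) {A : Set ℕ} {t : ℝ}
    (ht0 : 0 < t) (ht1 : t ≤ 1) (hA : A.Nonempty) (hApos : ∀ k ∈ A, 1 ≤ k)
    (h : WeakGreedyConverges b A t) : IsQuasiGreedy b := by
  obtain ⟨k, hk⟩ := hA
  intro x ρ hρ
  simp_rw [greedySum_eq_proj b hρ.1]
  refine h x (fun _ => k) _ fun m hm => ?_
  have hcard : ((Finset.range m).image ρ).card = m := by
    rw [Finset.card_image_of_injective _ hρ.1, Finset.card_range]
  have hthr := hρ.isThresholdSet m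
  refine ⟨hk, hcard, isWeakGreedySet_of_threshold b (D := ∅) (E := ∅) ht0.le (abs_nonneg _)
    ((hm k hk).trans_eq hcard.symm) (hApos k hk) one_pos
    (fun n hn _ => (mul_le_mul_of_nonneg_right ht1 (abs_nonneg _)).trans (hthr.1 n hn))
    fun n hn _ => hthr.2 n hn⟩

/-! ### Infinite index sets: unconditionality -/

theorem IsUnconditional.exists_norm_proj_le [CompleteSpace X] (b : SchauderBasis ℝ X)
    (h : IsUnconditional b) : ∃ C : ℝ, ∀ Γ, ‖GeneralSchauderBasis.proj b Γ‖ ≤ C :=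
  UnconditionalSchauderBasis.exists_norm_proj_le (X := X) (𝕜 := ℝ)
    { basis := b.basis
      coord := b.coord
      ortho := b.ortho
      expansion := fun x => by
        have h1 := (h x).hasSum
        have h2 : ∑' n, b.coord n x • b n = x := by
          refine tendsto_nhds_unique h1.tendsto_sum_nat ?_
          simpa using b.tendsto_proj x
        rwa [h2] at h1 }

/-- It suffices to bound the projections of finitely supported vectors. -/
theorem isUnconditional_of_norm_proj_le [CompleteSpace X] (b : SchauderBasis ℝ X) {C : ℝ}
    (hC : ∀ (x : X) (F Γ : Finset ℕ), (∀ n ∉ F, coeffs b x n = 0) →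
      ‖GeneralSchauderBasis.proj b Γ x‖ ≤ C * ‖x‖) : IsUnconditional b := by
  have hall : ∀ (x : X) (Γ : Finset ℕ), ‖GeneralSchauderBasis.proj b Γ x‖ ≤ C * ‖x‖ := by
    intro x Γ
    refine ge_of_tendsto ((b.tendsto_proj x).norm.const_mul C) ?_
    obtain ⟨N, hN⟩ := Γ.exists_nat_subset_range
    filter_upwards [eventually_ge_atTop N] with M hM
    rw [← proj_proj_of_subset b (hN.trans (Finset.range_mono hM)) x]
    exact hC _ (Finset.range M) Γ fun n hn => by rw [coeffs_proj, if_neg hn]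
  intro x
  rw [summable_iff_vanishing_norm]
  intro ε hε
  have hC1 : 0 < 1 + |C| := by positivity
  obtain ⟨N, hN⟩ := Metric.tendsto_atTop.mp (b.tendsto_proj x) (ε / (1 + |C|)) (by positivity)
  refine ⟨Finset.range N, fun Γ hΓ => ?_⟩
  have h1 := hall (x - b.proj N x) Γ
  have h2 : GeneralSchauderBasis.proj b Γ (b.proj N x) = 0 := by
    rw [proj_eq_sum]
    refine Finset.sum_eq_zero fun n hn => ?_
    rw [SchauderBasis.proj, coeffs_proj, if_neg (Finset.disjoint_left.mp hΓ hn), zero_smul]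
  rw [map_sub, h2, sub_zero, GeneralSchauderBasis.proj_apply] at h1
  have h3 := hN N le_rfl
  rw [dist_comm, dist_eq_norm, lt_div_iff₀ hC1] at h3
  have h4 := mul_le_mul_of_nonneg_right (le_abs_self C) (norm_nonneg (x - b.proj N x))
  linarith [norm_nonneg (x - b.proj N x)]

/-- A finite set can be enlarged by indices outside the finite set `F`, to any larger size. -/
theorem exists_pad (F Γ : Finset ℕ) {m : ℕ} (h : Γ.card ≤ m) :
    ∃ Γ' : Finset ℕ, Γ ⊆ Γ' ∧ Γ'.card = m ∧ ∀ n ∈ Γ', n ∉ Γ → n ∉ F := by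
  obtain ⟨T, hT, hTc⟩ := (F ∪ Γ).finite_toSet.infinite_compl.exists_subset_card_eq (m - Γ.card)
  have hT' : ∀ n ∈ T, n ∉ F ∧ n ∉ Γ := fun n hn => by simpa using hT hn
  refine ⟨Γ ∪ T, Finset.subset_union_left, ?_, fun n hn hnΓ => ?_⟩
  · rw [Finset.card_union_of_disjoint, hTc]
    · omega
    · exact Finset.disjoint_right.mpr fun n hn => (hT' n hn).2
  · exact (hT' n ((Finset.mem_union.mp hn).resolve_left hnΓ)).1

theorem HasQuasiGreedyProperty.isUnconditional_of_infinite_left [CompleteSpace X]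
    (b : SchauderBasis ℝ X) (hb : IsSemiNormalized b) {A B : Set ℕ} {t : ℝ} (ht0 : 0 < t)
    (ht1 : t ≤ 1) (hA : A.Infinite) (hB : B.Nonempty) (hBpos : ∀ l ∈ B, 1 ≤ l)
    (h : HasQuasiGreedyProperty b A B t) : IsUnconditional b := by
  obtain ⟨κ, hκ, hκb, hκc⟩ := exists_norm_bound b hb
  obtain ⟨C, hC, hbd⟩ := h
  obtain ⟨l, hl⟩ := hB
  refine isUnconditional_of_norm_proj_le b (C := C * (1 + κ * κ) + κ * κ) fun x F Γ hF => ?_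
  obtain ⟨k, hk, hkΓ⟩ := hA.exists_gt Γ.card
  -- The padded set has `k - 1` indices, all of which may carry small coefficients. One new index
  -- `N` with coefficient `r`, dominating all coefficients of `x`, supplies the `k`-th.
  obtain ⟨Δ, hΓΔ, hΔc, hΔF⟩ := exists_pad F Γ (Nat.le_sub_one_of_lt hkΓ)
  obtain ⟨N, hN⟩ := Infinite.exists_notMem_finset (F ∪ Δ)
  rw [Finset.mem_union, not_or] at hN
  set r := κ * ‖x‖ with hr
  have hr0 : 0 ≤ r := by positivity
  set y := x + r • b N with hy
  have hyc : ∀ n, coeffs b y n = coeffs b x n + r * if n = N then 1 else 0 := fun n => by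
    rw [hy, coeffs_add, coeffs_smul, coeffs_basis]
  have hyne : ∀ n, n ≠ N → coeffs b y n = coeffs b x n := fun n hn => by
    rw [hyc, if_neg hn, mul_zero, add_zero]
  have hyN : coeffs b y N = r := by rw [hyc, hF N hN.1]; simp
  have hcard : (insert N Δ).card = k := by
    rw [Finset.card_insert_of_notMem hN.2, hΔc]; omega
  have hw : IsWeakGreedySet b k l t y (insert N Δ) := by
    refine isWeakGreedySet_of_threshold b (α := r) (D := Δ) (E := ∅) ht0.le hr0 hcard.ge
      (by omega) (hBpos l hl) (fun n hn hnΔ => ?_) fun n hn _ => ?_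
    · rw [(Finset.mem_insert.mp hn).resolve_right hnΔ, hyN, abs_of_nonneg hr0]
      exact mul_le_of_le_one_left hr0 ht1
    · rw [hyne n fun h => hn (h ▸ Finset.mem_insert_self _ _)]
      exact hκc x n
  have h1 := hbd k hk l hl y _ hw
  have h2 : GeneralSchauderBasis.proj b (insert N Δ) y =
      r • b N + GeneralSchauderBasis.proj b Γ x := by
    rw [proj_subset b hΓΔ fun n hn hn' => hF n (hΔF n hn hn'), proj_eq_sum,
      Finset.sum_insert hN.2, hyN, ← proj_eq_sum]
    congr 1
    exact proj_congr b fun n hn => hyne n fun h => hN.2 (h ▸ hn)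
  have h3 : ‖r • b N‖ ≤ κ * κ * ‖x‖ := by
    rw [norm_smul, Real.norm_of_nonneg hr0]
    calc r * ‖b N‖ ≤ r * κ := by gcongr; exact hκb N
      _ = _ := by rw [hr]; ring
  have h4 : ‖y‖ ≤ (1 + κ * κ) * ‖x‖ := (norm_add_le _ _).trans (by linarith)
  have h5 : ‖GeneralSchauderBasis.proj b Γ x‖ ≤ C * ‖y‖ + κ * κ * ‖x‖ := by
    rw [← add_sub_cancel_left (r • b N) (GeneralSchauderBasis.proj b Γ x), ← h2]
    exact (norm_sub_le _ _).trans (add_le_add h1 h3)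
  have h6 := mul_le_mul_of_nonneg_left h4 hC.le
  linarith

theorem HasQuasiGreedyProperty.isUnconditional_of_infinite_right [CompleteSpace X]
    (b : SchauderBasis ℝ X) {A B : Set ℕ} {t : ℝ} (ht0 : 0 < t)
    (hA : A.Nonempty) (hApos : ∀ k ∈ A, 1 ≤ k) (hB : B.Infinite)
    (h : HasQuasiGreedyProperty b A B t) : IsUnconditional b := by
  obtain ⟨C, hC, hbd⟩ := h
  obtain ⟨k, hk⟩ := hA
  refine isUnconditional_of_norm_proj_le b (C := C) fun x F Γ hF => ?_
  -- With `l` larger than the support, the `l`-th largest outside modulus is zero, so only the size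
  -- requirement `k ≤ Δ.card` matters.
  obtain ⟨l, hl, hlF⟩ := hB.exists_gt F.card
  obtain ⟨Δ, hΓΔ, hΔc, hΔF⟩ := exists_pad F Γ (le_max_left Γ.card k)
  rw [proj_subset b hΓΔ fun n hn hn' => hF n (hΔF n hn hn')]
  refine hbd k hk l hl x Δ (isWeakGreedySet_of_threshold b (α := 0) (D := ∅) (E := F) ht0.le
    le_rfl ((le_max_right _ _).trans hΔc.ge) (hApos k hk) hlF (fun n _ _ => ?_) fun n _ hn => ?_)
  · rw [mul_zero]; exact abs_nonneg _
  · rw [hF n hn, abs_zero]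

theorem IsUnconditional.hasQuasiGreedyProperty [CompleteSpace X] (b : SchauderBasis ℝ X)
    (h : IsUnconditional b) (A B : Set ℕ) (t : ℝ) : HasQuasiGreedyProperty b A B t := by
  obtain ⟨C, hC⟩ := h.exists_norm_proj_le b
  refine ⟨max C 1, by positivity, fun k _ l _ x Γ _ => ?_⟩
  exact (GeneralSchauderBasis.proj b Γ).le_of_opNorm_le ((hC Γ).trans (le_max_left _ _)) x

end GreedyBasis

theorem theorem1p11 {X : Type*} [NormedAddCommGroup X] [NormedSpace ℝ X] [CompleteSpace X]
    (b : SchauderBasis ℝ X) (hb : GreedyBasis.IsSemiNormalized b)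
    (t : ℝ) (ht0 : 0 < t) (ht1 : t ≤ 1)
    (A B : Set ℕ) (hA : A.Nonempty) (hB : B.Nonempty)
    (hApos : ∀ k ∈ A, 1 ≤ k) (hBpos : ∀ l ∈ B, 1 ≤ l) :
    ((A ∪ B).Finite →
      (GreedyBasis.IsQuasiGreedy b ↔ GreedyBasis.HasQuasiGreedyProperty b A B t)) ∧
    ((A ∪ B).Finite →
      (GreedyBasis.IsQuasiGreedy b ↔ GreedyBasis.WeakGreedyConverges b A t)) ∧
    ((A ∪ B).Infinite →
      (GreedyBasis.HasQuasiGreedyProperty b A B t ↔ GreedyBasis.IsUnconditional b)) := by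
  have hqt : GreedyBasis.IsQuasiGreedy b → ∃ C, 0 ≤ C ∧ GreedyBasis.ThresholdBound b t C := by
    intro hq
    obtain ⟨C, hC1, hC⟩ := hq.exists_superlevelBound b hb
    exact hC.exists_thresholdBound b hb hC1 ht0
  refine ⟨fun hfin => ⟨fun hq => ?_, fun h => ?_⟩, fun hfin => ⟨fun hq => ?_, fun h => ?_⟩,
    fun hinf => ⟨fun h => ?_, fun h => h.hasQuasiGreedyProperty b A B t⟩⟩
  · obtain ⟨C, hC0, hC⟩ := hqt hq
    exact hC.hasQuasiGreedyProperty b hb ht1 hfin hApos hBpos hC0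
  · obtain ⟨C, hC⟩ := h.exists_thresholdBound b hb ht0 ht1 hA hB hApos hBpos
    exact hC.isQuasiGreedy b hb
  · obtain ⟨C, -, hC⟩ := hqt hq
    exact hC.weakGreedyConverges b hb ht0 ht1 (hfin.subset Set.subset_union_left) hApos
  · exact h.isQuasiGreedy b ht0 ht1 hA hApos
  · rcases Set.infinite_union.mp hinf with hinf | hinf
    · exact h.isUnconditional_of_infinite_left b hb ht0 ht1 hinf hB hBpos
    · exact h.isUnconditional_of_infinite_right b ht0 hA hApos hinf
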